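/- **Theorem 2.** Consider a linear system $\dot x = Ax+Bu$, $y = Cx$ with $x\in\mathbb{R}^n$, $u\in\mathbb{R}^m$, $y\in\mathbb{R}^l$, and assume that it is left-invertible, i.e. that from the initial state $x(0)=0$ two inputs which produce the same output on $[0,\infty)$ coincide. Then the system is output-input stable if and only if all its transmission zeros have negative real parts. Here the system is called *output-input stable* if there exist a positive integer $N$, a class $\mathcal{KL}$ function $\beta$ and a class $\mathcal{K}_\infty$ function $\gamma$ such that for every initial state $x(0)$ and every $N-1$ times continuously differentiable input $u:[0,\infty)\to\mathbb{R}^m$ the corresponding solution satisfies $$\left|\begin{pmatrix}u(t)\\x(t)\end{pmatrix}\right|\le \beta(|x(0)|,t)+\gamma\Big(\sup_{0\le s\le t}|\mathbf{y}^N(s)|\Big)\qquad\text{for all }t\ge 0,$$ where $|\cdot|$ is the Euclidean norm and $\mathbf{y}^N$ is the vector of all components of $y,\dot y,\dots,y^{(N)}$. (A function $\alpha:[0,\infty)\to[0,\infty)$ is of class $\mathcal K$ if it is continuous, strictly increasing and $\alpha(0)=0$, and of class $\mathcal K_\infty$ if it is moreover unbounded; $\beta:[0,\infty)^2\to[0,\infty)$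 is of class $\mathcal{KL}$ if $\beta(\cdot,t)$ is of class $\mathcal K$ for each $t$ and $\beta(s,t)$ decreases to $0$ as $t\to\infty$ for each $s$.) A subspace $\mathcal V\subset\mathbb{R}^n$ is *$(A,B)$-invariant* if $(A+BF)\mathcal V\subset\mathcal V$ for some $m\times n$ matrix $F$. Let $\mathcal S$ be the largest $(A,B)$-invariant subspace contained in $\ker C$. The *transmission zeros* of the system are the (complex) eigenvalues of the restriction of $A+BF$ to $\mathcal S$, where $F$ is such that $(A+BF)\mathcal S\subset\mathcal S$; for a left-invertible system they do not depend on the choice of $F$. -/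

import Mathlib

open scoped NNReal ContDiff
open Set Filter Topology

namespace OutputInput

/-- Class `𝒦`: continuous, strictly increasing functions `[0,∞) → [0,∞)` vanishing at `0`. -/
structure IsClassK (α : ℝ≥0 → ℝ≥0) : Prop where
  continuous : Continuous α
  strictMono : StrictMono α
  map_zero : α 0 = 0

/-- Class `𝒦_∞`: unbounded functions of class `𝒦`. -/
structure IsClassKInf (α : ℝ≥0 → ℝ≥0) : Prop extends IsClassK α where
  unbounded : ∀ M : ℝ≥0, ∃ s, M < α s

/-- Class `𝒦ℒ`: `β(·, t)` is of class `𝒦` for each `t`, and `β(s, t)` decreases to `0` as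
`t → ∞` for each `s`. -/
structure IsClassKL (β : ℝ≥0 → ℝ≥0 → ℝ≥0) : Prop where
  classK : ∀ t, IsClassK (fun s => β s t)
  antitone : ∀ s, Antitone (β s)
  tendsto_zero : ∀ s, Tendsto (β s) atTop (𝓝 0)

/-- A smooth control system `ẋ = f(x, u)`, `y = h(x)` with state in `ℝⁿ`, input in `ℝᵐ` and
output in `ℝˡ`. -/
structure ControlSystem (n m l : ℕ) where
  f : EuclideanSpace ℝ (Fin n) → EuclideanSpace ℝ (Fin m) → EuclideanSpace ℝ (Fin n)
  h : EuclideanSpace ℝ (Fin n) → EuclideanSpace ℝ (Fin l)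
  smooth_f : ContDiff ℝ ∞ (fun p : EuclideanSpace ℝ (Fin n) × EuclideanSpace ℝ (Fin m) =>
    f p.1 p.2)
  smooth_h : ContDiff ℝ ∞ h

variable {n m l : ℕ}

/-- `x` is a (classical) solution of `ẋ = f(x, u)` on the interval `I`; derivatives at endpoints
of `I` are one-sided. -/
def ControlSystem.IsSolutionOn (sys : ControlSystem n m l)
    (u : ℝ → EuclideanSpace ℝ (Fin m)) (x : ℝ → EuclideanSpace ℝ (Fin n)) (I : Set ℝ) : Prop :=
  ∀ t ∈ I, HasDerivWithinAt x (sys.f (x t) (u t)) I t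

/-- The stacked signal `𝐳ᵏ = (z₁; ż₁; …; z₁⁽ᵏ⁾; …; z_l; ż_l; …; z_l⁽ᵏ⁾)` of a signal `z` defined
on the interval `I`; derivatives at endpoints of `I` are one-sided. -/
noncomputable def jet (z : ℝ → EuclideanSpace ℝ (Fin l)) (k : ℕ) (I : Set ℝ) (t : ℝ) :
    EuclideanSpace ℝ (Fin l × Fin (k + 1)) :=
  WithLp.toLp 2 fun p => iteratedDerivWithin (p.2 : ℕ) (fun s => z s p.1) I t

/-- The supremum norm `‖z‖_[a,b]`. It is only applied to continuous signals, where it is the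
essential supremum norm if `a < b` (and equals `|z(a)|` if `a = b`). -/
noncomputable def supNorm {E : Type*} [NormedAddCommGroup E] (z : ℝ → E) (a b : ℝ) : ℝ≥0 :=
  sSup ((fun s => ‖z s‖₊) '' Icc a b)

/-- Output-input stability: for some positive integer `N`, `β ∈ 𝒦ℒ` and `γ ∈ 𝒦_∞`, every solution
with an input of class `C^(N-1)` satisfies `|(u(t); x(t))| ≤ β(|x(0)|, t) + γ(‖𝐲ᴺ‖_[0,t])` at all
times of its domain. By uniqueness of solutions, the maximal solution is the union of
the solutions on the compact intervals `[0, T]` in its domain. -/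
def ControlSystem.IsOutputInputStable (sys : ControlSystem n m l) : Prop :=
  ∃ (N : ℕ) (β : ℝ≥0 → ℝ≥0 → ℝ≥0) (γ : ℝ≥0 → ℝ≥0),
    0 < N ∧ IsClassKL β ∧ IsClassKInf γ ∧
    ∀ u : ℝ → EuclideanSpace ℝ (Fin m), ContDiffOn ℝ (N - 1 : ℕ) u (Ici 0) →
    ∀ (T : ℝ) (x : ℝ → EuclideanSpace ℝ (Fin n)), 0 < T → sys.IsSolutionOn u x (Icc 0 T) →
    ∀ t ∈ Icc 0 T,
      ‖(WithLp.toLp 2 (u t, x t) :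
          WithLp 2 (EuclideanSpace ℝ (Fin m) × EuclideanSpace ℝ (Fin n)))‖₊ ≤
        β ‖x 0‖₊ t.toNNReal +
          γ (supNorm (jet (fun s => sys.h (x s)) N (Icc 0 T)) 0 t)

/-- The linear system `ẋ = A x + B u`, `y = C x`. -/
noncomputable def linearSystem (A : Matrix (Fin n) (Fin n) ℝ) (B : Matrix (Fin n) (Fin m) ℝ)
    (C : Matrix (Fin l) (Fin n) ℝ) : ControlSystem n m l where
  f x u := A.toEuclideanLin x + B.toEuclideanLin u
  h x := C.toEuclideanLin x
  smooth_f :=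
    (A.toEuclideanLin.toContinuousLinearMap.contDiff.comp contDiff_fst).add
      (B.toEuclideanLin.toContinuousLinearMap.contDiff.comp contDiff_snd)
  smooth_h := C.toEuclideanLin.toContinuousLinearMap.contDiff

/-- Left-invertibility: from the zero initial state, the output determines the input. -/
def IsLeftInvertible (A : Matrix (Fin n) (Fin n) ℝ) (B : Matrix (Fin n) (Fin m) ℝ)
    (C : Matrix (Fin l) (Fin n) ℝ) : Prop :=
  ∀ (u₁ u₂ : ℝ → EuclideanSpace ℝ (Fin m)) (x₁ x₂ : ℝ → EuclideanSpace ℝ (Fin n)),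
    ContinuousOn u₁ (Ici 0) → ContinuousOn u₂ (Ici 0) →
    (linearSystem A B C).IsSolutionOn u₁ x₁ (Ici 0) →
    (linearSystem A B C).IsSolutionOn u₂ x₂ (Ici 0) →
    x₁ 0 = 0 → x₂ 0 = 0 →
    (∀ t ∈ Ici (0 : ℝ), C.toEuclideanLin (x₁ t) = C.toEuclideanLin (x₂ t)) →
    ∀ t ∈ Ici (0 : ℝ), u₁ t = u₂ t

/-- The matrix `F` satisfies `(A + B F) V ⊆ V`. -/
def IsFriend (A : Matrix (Fin n) (Fin n) ℝ) (B : Matrix (Fin n) (Fin m) ℝ)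
    (V : Submodule ℝ (EuclideanSpace ℝ (Fin n))) (F : Matrix (Fin m) (Fin n) ℝ) : Prop :=
  ∀ v ∈ V, (A + B * F).toEuclideanLin v ∈ V

/-- The family of `(A, B)`-invariant subspaces that are contained in `ker C`. -/
def invariantFamily (A : Matrix (Fin n) (Fin n) ℝ) (B : Matrix (Fin n) (Fin m) ℝ)
    (C : Matrix (Fin l) (Fin n) ℝ) : Set (Submodule ℝ (EuclideanSpace ℝ (Fin n))) :=
  {V | (∃ F : Matrix (Fin m) (Fin n) ℝ, IsFriend A B V F) ∧ V ≤ LinearMap.ker C.toEuclideanLin}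

/-- The largest `(A, B)`-invariant subspace contained in `ker C`
(see `isGreatest_maxInvariant`). -/
noncomputable def maxInvariant (A : Matrix (Fin n) (Fin n) ℝ) (B : Matrix (Fin n) (Fin m) ℝ)
    (C : Matrix (Fin l) (Fin n) ℝ) : Submodule ℝ (EuclideanSpace ℝ (Fin n)) :=
  sSup (invariantFamily A B C)

/-- `V` is `(A, B)`-invariant if and only if `A V ⊆ V + im B`. -/
theorem exists_isFriend_iff (A : Matrix (Fin n) (Fin n) ℝ) (B : Matrix (Fin n) (Fin m) ℝ)
    (V : Submodule ℝ (EuclideanSpace ℝ (Fin n))) :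
    (∃ F : Matrix (Fin m) (Fin n) ℝ, IsFriend A B V F) ↔
      V.map A.toEuclideanLin ≤ V ⊔ LinearMap.range B.toEuclideanLin := by
  have key : ∀ (F : Matrix (Fin m) (Fin n) ℝ) (v : EuclideanSpace ℝ (Fin n)),
      (A + B * F).toEuclideanLin v =
        A.toEuclideanLin v + B.toEuclideanLin (F.toEuclideanLin v) := by
    intro F v
    ext i
    simp [Matrix.toLpLin_apply, Matrix.mulVec_mulVec]
  constructor
  · rintro ⟨F, hF⟩ _ ⟨v, hv, rfl⟩
    have h := hF v hv
    rw [key] at h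
    have h2 : A.toEuclideanLin v = (A.toEuclideanLin v + B.toEuclideanLin (F.toEuclideanLin v)) +
        B.toEuclideanLin (-F.toEuclideanLin v) := by simp
    rw [h2]
    exact Submodule.add_mem_sup h ⟨_, rfl⟩
  · intro h
    have hb : ∀ i, ∃ w : EuclideanSpace ℝ (Fin m),
        A.toEuclideanLin (Module.finBasis ℝ V i : EuclideanSpace ℝ (Fin n)) +
          B.toEuclideanLin w ∈ V := by
      intro i
      obtain ⟨a, ha, b, ⟨w, rfl⟩, hab⟩ :=
        Submodule.mem_sup.1 (h ⟨_, (Module.finBasis ℝ V i).2, rfl⟩)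
      refine ⟨-w, ?_⟩
      rw [← hab]
      simpa using ha
    choose w hw using hb
    obtain ⟨G, hG⟩ := LinearMap.exists_extend ((Module.finBasis ℝ V).constr ℝ w)
    refine ⟨Matrix.toEuclideanLin.symm G, fun v hv => ?_⟩
    rw [key, LinearEquiv.apply_symm_apply]
    let L : V →ₗ[ℝ] EuclideanSpace ℝ (Fin n) :=
      (A.toEuclideanLin + B.toEuclideanLin ∘ₗ G) ∘ₗ V.subtype
    have hL : ∀ v, V.mkQ (L v) = 0 := by
      intro v
      have : V.mkQ ∘ₗ L = 0 := by
        refine (Module.finBasis ℝ V).ext fun i => ?_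
        have hGi : G (Module.finBasis ℝ V i : EuclideanSpace ℝ (Fin n)) = w i := by
          have := LinearMap.congr_fun hG (Module.finBasis ℝ V i)
          simpa using this
        simpa [L, hGi] using (Submodule.Quotient.mk_eq_zero V).2 (hw i)
      exact LinearMap.congr_fun this v
    simpa [L] using (Submodule.Quotient.mk_eq_zero V).1 (hL ⟨v, hv⟩)

/-- The largest `(A, B)`-invariant subspace contained in `ker C` exists. -/
theorem isGreatest_maxInvariant (A : Matrix (Fin n) (Fin n) ℝ) (B : Matrix (Fin n) (Fin m) ℝ)
    (C : Matrix (Fin l) (Fin n) ℝ) :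
    IsGreatest (invariantFamily A B C) (maxInvariant A B C) := by
  refine ⟨⟨(exists_isFriend_iff A B _).2 ?_, sSup_le fun V hV => hV.2⟩, fun V hV => le_sSup hV⟩
  rw [Submodule.map_le_iff_le_comap]
  refine sSup_le fun V hV => ?_
  rw [← Submodule.map_le_iff_le_comap]
  exact ((exists_isFriend_iff A B V).1 hV.1).trans (sup_le_sup_right (le_sSup hV) _)

/-- The transmission zeros: the complex eigenvalues (roots of the characteristic polynomial) of the
restriction of `A + B F` to the largest `(A, B)`-invariant subspace `𝒮` in `ker C`, where
`(A + B F) 𝒮 ⊆ 𝒮`. -/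
def IsTransmissionZero (A : Matrix (Fin n) (Fin n) ℝ) (B : Matrix (Fin n) (Fin m) ℝ)
    (C : Matrix (Fin l) (Fin n) ℝ) (μ : ℂ) : Prop :=
  ∃ (F : Matrix (Fin m) (Fin n) ℝ) (hF : IsFriend A B (maxInvariant A B C) F),
    Polynomial.aeval μ ((A + B * F).toEuclideanLin.restrict hF).charpoly = 0

end OutputInput

/-! Let `S` be the largest controlled invariant subspace in `ker C`, with friend `F`.

Sufficiency rests on duality. The functionals of `(x, u)` that are combinations of output
derivatives along all trajectories form a subspace `D`, and differentiating a member of `D` that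
depends on `x` alone gives another member. Hence the states killed by all pure state functionals in
`D` form a controlled invariant subspace of `ker C`, so they lie in `S`. Left-invertibility gives `B
w ∈ S → w = 0`, which puts the common kernel of `D` inside the graph of `F` over `S`. By
finite-dimensional duality, `D` contains every functional vanishing on that graph
(`mem_determinedFunctionals`). So the part of `x` transversal to `S`, and `u - F x`, are bounded by
output derivatives. The component of `x` in `S` follows the zero dynamics driven by these bounded
terms, and `exists_decay_of_charpoly` bounds it.

Necessity: from a state in `S` the input `u = F x` produces zero output, so the estimate forces
decay, while an eigenvalue with nonnegative real part gives a zero-output solution that does not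
decay. -/

namespace OutputInput

/-! ### Input-to-state estimates from a factored annihilating polynomial -/

section Stability

variable {W : Type*} [NormedAddCommGroup W] [NormedSpace ℂ W]

/-- Variation-of-constants bound for `ż = μ z + g` with `Re μ < 0`. -/
theorem norm_le_of_scalar_ode {μ : ℂ} {b P M T : ℝ} (hb : 0 < b) (hbμ : b < -μ.re)
    (hP : 0 ≤ P) (hM : 0 ≤ M) {z g : ℝ → W}
    (hz : ∀ t ∈ Icc 0 T, HasDerivWithinAt z (μ • z t + g t) (Icc 0 T) t)
    (hg : ∀ t ∈ Icc 0 T, ‖g t‖ ≤ P * Real.exp (-b * t) + M) :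
    ∀ t ∈ Icc 0 T, ‖z t‖ ≤ (‖z 0‖ + P / (-μ.re - b)) * Real.exp (-b * t) + M / (-μ.re) := by
  intro t ht
  set a : ℝ := -μ.re with ha
  have ha0 : 0 < a := hb.trans hbμ
  have hab : 0 < a - b := sub_pos.2 hbμ
  have hexp : ∀ s : ℝ, HasDerivAt (fun s : ℝ => Complex.exp (-μ * s))
      (-μ * Complex.exp (-μ * s)) s := by
    intro s
    have h1 : HasDerivAt (fun s : ℝ => -μ * (s : ℂ)) (-μ) s := by
      simpa using (Complex.ofRealCLM.hasDerivAt (x := s)).const_mul (-μ)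
    simpa [mul_comm] using h1.cexp
  have hnorm : ∀ s : ℝ, ‖Complex.exp (-μ * s)‖ = Real.exp (a * s) := by
    intro s
    rw [Complex.norm_exp]
    simp [ha]
  have hf : ∀ s ∈ Icc 0 T, HasDerivWithinAt (fun s : ℝ => Complex.exp (-μ * s) • z s)
      (Complex.exp (-μ * s) • g s) (Icc 0 T) s := by
    intro s hs
    have h := (hexp s).hasDerivWithinAt (s := Icc 0 T) |>.smul (hz s hs)
    refine h.congr_deriv ?_
    module
  -- The comparison function is `‖z 0‖` plus an antiderivative of `exp (a s) (P exp (-b s) + M)`,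
  -- which bounds the derivative of `exp (-μ s) z`.
  have hB : ∀ s : ℝ, HasDerivAt
      (fun s : ℝ => ‖z 0‖ + P / (a - b) * Real.exp ((a - b) * s) + M / a * Real.exp (a * s))
      (P * Real.exp ((a - b) * s) + M * Real.exp (a * s)) s := by
    intro s
    have e : ∀ c : ℝ, HasDerivAt (fun s : ℝ => Real.exp (c * s)) (c * Real.exp (c * s)) s := by
      intro c
      simpa [mul_comm] using ((hasDerivAt_id s).const_mul c).exp
    have h := (((e (a - b)).const_mul (P / (a - b))).const_add ‖z 0‖).add
      ((e a).const_mul (M / a))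
    refine h.congr_deriv ?_
    field_simp
  have key := image_norm_le_of_norm_deriv_right_le_deriv_boundary
    (f := fun s : ℝ => Complex.exp (-μ * s) • z s) (f' := fun s => Complex.exp (-μ * s) • g s)
    (a := 0) (b := T) (fun s hs => (hf s hs).continuousWithinAt)
    (fun s hs => (hf s ⟨hs.1, hs.2.le⟩).mono_of_mem_nhdsWithin (Icc_mem_nhdsGE_of_mem hs))
    (B := fun s : ℝ => ‖z 0‖ + P / (a - b) * Real.exp ((a - b) * s) + M / a * Real.exp (a * s))
    (by simp only [Complex.ofReal_zero, mul_zero, Complex.exp_zero, one_smul, Real.exp_zero]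
        have := div_nonneg hP hab.le
        have := div_nonneg hM ha0.le
        linarith) hB
    (fun s hs => by
      rw [norm_smul, hnorm]
      calc Real.exp (a * s) * ‖g s‖ ≤ Real.exp (a * s) * (P * Real.exp (-b * s) + M) := by
            gcongr
            exact hg s ⟨hs.1, hs.2.le⟩
        _ = _ := by
            rw [show (a - b) * s = a * s + -b * s by ring, Real.exp_add]
            ring) ht
  simp only [norm_smul, hnorm] at key
  have hpos := Real.exp_pos (a * t)
  have hle : Real.exp (-a * t) ≤ Real.exp (-b * t) :=
    Real.exp_le_exp.2 (mul_le_mul_of_nonneg_right (by linarith) ht.1)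
  have h1 : Real.exp (a * t) * Real.exp (-a * t) = 1 := by
    rw [← Real.exp_add]; simp
  have h2 : Real.exp ((a - b) * t) = Real.exp (a * t) * Real.exp (-b * t) := by
    rw [← Real.exp_add]; ring_nf
  have h3 : ‖z 0‖ ≤ Real.exp (a * t) * (‖z 0‖ * Real.exp (-b * t)) := by
    calc ‖z 0‖ = ‖z 0‖ * (Real.exp (a * t) * Real.exp (-a * t)) := by rw [h1, mul_one]
      _ ≤ ‖z 0‖ * (Real.exp (a * t) * Real.exp (-b * t)) := by gcongr
      _ = _ := by ring
  refine le_of_mul_le_mul_left (key.trans ?_) hpos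
  rw [h2]
  calc _ ≤ Real.exp (a * t) * (‖z 0‖ * Real.exp (-b * t)) +
        P / (a - b) * (Real.exp (a * t) * Real.exp (-b * t)) + M / a * Real.exp (a * t) := by
        gcongr
    _ = _ := by ring

/-- If a product of factors `f - μᵢ` with `Re μᵢ < 0` annihilates the solution of `ż = f z + w`,
the solution is input-to-state stable. -/
theorem exists_decay_of_aeval_prod (f : W →L[ℂ] W) (s : Multiset ℂ) (hs : ∀ μ ∈ s, μ.re < 0) :
    ∃ K lam : ℝ, 0 ≤ K ∧ 0 < lam ∧ ∀ (T M : ℝ) (z w : ℝ → W),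
      (∀ t ∈ Icc 0 T, HasDerivWithinAt z (f (z t) + w t) (Icc 0 T) t) →
      (∀ t ∈ Icc 0 T, ‖w t‖ ≤ M) →
      (∀ t, Polynomial.aeval (f : W →ₗ[ℂ] W)
        (s.map fun μ => Polynomial.X - Polynomial.C μ).prod (z t) = 0) →
      ∀ t ∈ Icc 0 T, ‖z t‖ ≤ K * (‖z 0‖ * Real.exp (-lam * t) + M) := by
  induction s using Multiset.induction_on with
  | empty =>
    -- The empty product is `1`, so the annihilation hypothesis says `z = 0`.
    refine ⟨0, 1, le_rfl, one_pos, fun T M z w _ _ h t _ => ?_⟩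
    have := h t
    simp_all
  | cons μ s ih =>
    obtain ⟨K, lam, hK, hlam, ih⟩ := ih fun ν hν => hs ν (Multiset.mem_cons_of_mem hν)
    have hμ := hs μ (Multiset.mem_cons_self μ s)
    -- `q z` solves the same equation with input `q w` and is annihilated by the remaining factors.
    -- Then `ż = μ z + (q z + w)` is a scalar-type equation with controlled forcing.
    set q : W →L[ℂ] W := f - μ • ContinuousLinearMap.id ℂ W with hq
    -- Halving keeps the rate strictly below `-μ.re`, which avoids resonance with the forcing.
    set b : ℝ := min lam (-μ.re / 2) with hb
    have hb0 : 0 < b := lt_min hlam (by linarith)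
    have hbμ : b < -μ.re := (min_le_right _ _).trans_lt (by linarith)
    have hd : 0 < -μ.re - b := sub_pos.2 hbμ
    set K₁ : ℝ := K * ‖q‖ with hK₁
    have hK₁0 : 0 ≤ K₁ := by positivity
    have hc1 : 0 ≤ K₁ / (-μ.re - b) := by positivity
    have hc2 : 0 ≤ (K₁ + 1) / (-μ.re) := div_nonneg (by positivity) (by linarith)
    refine ⟨1 + K₁ / (-μ.re - b) + (K₁ + 1) / (-μ.re), b, by positivity, hb0, ?_⟩
    intro T M z w hz hw hann t ht
    have hM : 0 ≤ M := (norm_nonneg _).trans (hw t ht)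
    have hz₁ := ih T (‖q‖ * M) (fun t => q (z t)) (fun t => q (w t))
      (fun r hr => by
        have h := (q.restrictScalars ℝ).hasFDerivAt.comp_hasDerivWithinAt r (hz r hr)
        refine h.congr_deriv ?_
        simp only [hq, ContinuousLinearMap.coe_restrictScalars', _root_.sub_apply,
          _root_.smul_apply, ContinuousLinearMap.id_apply, map_add, map_sub,
          map_smul])
      (fun r hr => (q.le_opNorm _).trans (by gcongr; exact hw r hr))
      (fun r => by
        have h := hann r
        rw [Multiset.map_cons, Multiset.prod_cons, mul_comm, map_mul] at h
        simpa [hq, Module.algebraMap_end_eq_smul_id] using h)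
    have hz₂ := norm_le_of_scalar_ode (T := T) (z := z) (g := fun t => q (z t) + w t)
      (P := K₁ * ‖z 0‖) (M := (K₁ + 1) * M) hb0 hbμ (by positivity) (by positivity)
      (fun r hr => by
        refine (hz r hr).congr_deriv ?_
        simp only [hq, _root_.sub_apply, _root_.smul_apply,
          ContinuousLinearMap.id_apply]
        abel)
      (fun r hr => by
        refine (norm_add_le _ _).trans ?_
        have h1 := hz₁ r hr
        have h2 := hw r hr
        have h3 : ‖q (z 0)‖ * Real.exp (-lam * r) ≤ ‖q‖ * ‖z 0‖ * Real.exp (-b * r) := by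
          gcongr
          · exact q.le_opNorm _
          · exact hr.1
          · exact min_le_left _ _
        calc _ ≤ K * (‖q‖ * ‖z 0‖ * Real.exp (-b * r) + ‖q‖ * M) + M := by
              refine add_le_add (h1.trans ?_) h2
              gcongr
          _ = _ := by rw [hK₁]; ring) t ht
    refine hz₂.trans ?_
    have he : 0 ≤ ‖z 0‖ * Real.exp (-b * t) := by positivity
    have h1 : (‖z 0‖ + K₁ * ‖z 0‖ / (-μ.re - b)) * Real.exp (-b * t) + (K₁ + 1) * M / -μ.re =
      (1 + K₁ / (-μ.re - b)) * (‖z 0‖ * Real.exp (-b * t)) + (K₁ + 1) / (-μ.re) * M := by ring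
    rw [h1]
    nlinarith [mul_nonneg hc2 he, mul_nonneg hc1 hM]

end Stability

/-! ### Passage between real and complex spectra -/

section Complexify

variable {V : Type*} [NormedAddCommGroup V] [NormedSpace ℝ V] [FiniteDimensional ℝ V]

/-- The complexified matrix of a real endomorphism in the standard finite basis. -/
noncomputable def complexMatrix (f : V →ₗ[ℝ] V) :
    Matrix (Fin (Module.finrank ℝ V)) (Fin (Module.finrank ℝ V)) ℂ :=
  (LinearMap.toMatrix (Module.finBasis ℝ V) (Module.finBasis ℝ V) f).map (algebraMap ℝ ℂ)

theorem complexMatrix_charpoly (f : V →ₗ[ℝ] V) :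
    (complexMatrix f).charpoly = f.charpoly.map (algebraMap ℝ ℂ) := by
  rw [complexMatrix, Matrix.charpoly_map, LinearMap.charpoly_toMatrix]

/-- The real-linear coordinate embedding of a real vector space into `ℂᵈ`. -/
noncomputable def complexCoord (V : Type*) [NormedAddCommGroup V] [NormedSpace ℝ V]
    [FiniteDimensional ℝ V] : V →ₗ[ℝ] (Fin (Module.finrank ℝ V) → ℂ) where
  toFun v i := ((Module.finBasis ℝ V).repr v i : ℂ)
  map_add' v w := by ext i; simp
  map_smul' r v := by ext i; simp

theorem complexMatrix_mulVec (f : V →ₗ[ℝ] V) (v : V) :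
    (complexMatrix f).mulVec (complexCoord V v) = complexCoord V (f v) := by
  ext i
  have h := congrFun (LinearMap.toMatrix_mulVec_repr (Module.finBasis ℝ V)
    (Module.finBasis ℝ V) f v) i
  simp only [complexCoord, LinearMap.coe_mk, AddHom.coe_mk, ← h]
  simp [complexMatrix, Matrix.mulVec, dotProduct]

/-- In finite dimension this makes the embedding antilipschitz, so bounds in `ℂᵈ` pull back to `V`.
-/
theorem complexCoord_ker : LinearMap.ker (complexCoord V) = ⊥ := by
  rw [LinearMap.ker_eq_bot']
  intro v hv
  apply (Module.finBasis ℝ V).repr.injective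
  ext i
  simpa [complexCoord] using congrFun hv i

/-- A linear system `ż = f z + w` whose characteristic roots have negative real parts is
input-to-state stable with linear gain. -/
theorem exists_decay_of_charpoly (f : V →ₗ[ℝ] V)
    (hf : ∀ μ : ℂ, Polynomial.aeval μ f.charpoly = 0 → μ.re < 0) :
    ∃ K lam : ℝ, 0 ≤ K ∧ 0 < lam ∧ ∀ (T M : ℝ) (z w : ℝ → V),
      (∀ t ∈ Icc 0 T, HasDerivWithinAt z (f (z t) + w t) (Icc 0 T) t) →
      (∀ t ∈ Icc 0 T, ‖w t‖ ≤ M) →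
      ∀ t ∈ Icc 0 T, ‖z t‖ ≤ K * (‖z 0‖ * Real.exp (-lam * t) + M) := by
  set g : (Fin (Module.finrank ℝ V) → ℂ) →L[ℂ] (Fin (Module.finrank ℝ V) → ℂ) :=
    LinearMap.toContinuousLinearMap (Matrix.toLin' (complexMatrix f)) with hg
  -- Over `ℂ` the characteristic polynomial splits, and Cayley–Hamilton makes it the required
  -- annihilating product.
  have hch : (complexMatrix f).charpoly =
      ((complexMatrix f).charpoly.roots.map fun μ => Polynomial.X - Polynomial.C μ).prod :=
    (IsAlgClosed.splits _).eq_prod_roots_of_monic (Matrix.charpoly_monic _)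
  obtain ⟨K, lam, hK, hlam, h⟩ := exists_decay_of_aeval_prod g (complexMatrix f).charpoly.roots
    (fun μ hμ => hf μ (by
      have h := (Polynomial.mem_roots'.1 hμ).2
      rwa [complexMatrix_charpoly, Polynomial.IsRoot, Polynomial.eval_map_algebraMap] at h))
  obtain ⟨κ, hκ, hanti⟩ := (complexCoord V).exists_antilipschitzWith complexCoord_ker
  set J : V →L[ℝ] (Fin (Module.finrank ℝ V) → ℂ) := (complexCoord V).toContinuousLinearMap with hJ
  refine ⟨κ * (K * ‖J‖), lam, by positivity, hlam, fun T M z w hz hw t ht => ?_⟩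
  have hJg : ∀ v, g (J v) = J (f v) := fun v => complexMatrix_mulVec f v
  have h1 := h T (‖J‖ * M) (fun t => J (z t)) (fun t => J (w t))
    (fun r hr => by
      have h := J.hasFDerivAt.comp_hasDerivWithinAt r (hz r hr)
      refine h.congr_deriv ?_
      rw [map_add, ← hJg])
    (fun r hr => (J.le_opNorm _).trans (by gcongr; exact hw r hr))
    (fun r => by
      rw [← hch]
      have h := LinearMap.aeval_self_charpoly (Matrix.toLin' (complexMatrix f))
      rw [Matrix.charpoly_toLin'] at h
      exact LinearMap.congr_fun h _) t ht
  have h2 : ‖z t‖ ≤ κ * ‖J (z t)‖ := by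
    have := hanti.le_mul_dist (z t) 0
    simpa [dist_eq_norm, hJ] using this
  calc ‖z t‖ ≤ κ * (K * (‖J (z 0)‖ * Real.exp (-lam * t) + ‖J‖ * M)) :=
        h2.trans (by gcongr)
    _ ≤ κ * (K * (‖J‖ * ‖z 0‖ * Real.exp (-lam * t) + ‖J‖ * M)) := by
        gcongr
        exact J.le_opNorm _
    _ = _ := by ring

/-- A complex root of the characteristic polynomial of a real endomorphism yields a real pair
`(a, b)`, the real and imaginary part of a complex eigenvector. -/
theorem exists_eigenpair_of_charpoly_root (f : V →ₗ[ℝ] V) (μ : ℂ)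
    (hμ : Polynomial.aeval μ f.charpoly = 0) :
    ∃ a b : V, (a ≠ 0 ∨ b ≠ 0) ∧ f a = μ.re • a - μ.im • b ∧ f b = μ.im • a + μ.re • b := by
  have hdet : (Matrix.scalar _ μ - complexMatrix f).det = 0 := by
    rw [← Matrix.eval_charpoly, complexMatrix_charpoly, Polynomial.eval_map_algebraMap, hμ]
  obtain ⟨v, hv0, hv⟩ := Matrix.exists_mulVec_eq_zero_iff.2 hdet
  have hv' : (complexMatrix f).mulVec v = μ • v := by
    rw [Matrix.sub_mulVec, sub_eq_zero] at hv
    rw [← hv]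
    ext i
    simp [Matrix.scalar_apply, Matrix.mulVec_diagonal]
  set e := Module.finBasis ℝ V
  have hcoord : ∀ c : Fin (Module.finrank ℝ V) → ℝ, ∀ i,
      e.repr (f (e.equivFun.symm c)) i = (LinearMap.toMatrix e e f).mulVec c i := by
    intro c i
    rw [← LinearMap.toMatrix_mulVec_repr e e f]
    congr 1
    exact e.equivFun.apply_symm_apply c
  have hsymm : ∀ (c : Fin (Module.finrank ℝ V) → ℝ) i, e.repr (e.equivFun.symm c) i = c i :=
    fun c i => congrFun (e.equivFun.apply_symm_apply c) i
  refine ⟨e.equivFun.symm fun i => (v i).re, e.equivFun.symm fun i => (v i).im, ?_, ?_, ?_⟩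
  · by_contra! hcon
    apply hv0
    ext i
    have h1 := congrFun ((LinearEquiv.map_eq_zero_iff _).1 hcon.1) i
    have h2 := congrFun ((LinearEquiv.map_eq_zero_iff _).1 hcon.2) i
    exact Complex.ext h1 h2
  · apply e.repr.injective
    ext i
    have h := congrArg Complex.re (congrFun hv' i)
    simp only [Matrix.mulVec, dotProduct, complexMatrix, Matrix.map_apply, Complex.re_sum,
      Complex.coe_algebraMap, Complex.ofReal_re, Complex.ofReal_im, zero_mul, sub_zero, Pi.smul_apply, smul_eq_mul,
      Complex.mul_re] at h
    rw [hcoord]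
    simp only [map_sub, map_smul, Finsupp.sub_apply, Finsupp.smul_apply, hsymm, smul_eq_mul,
      Matrix.mulVec, dotProduct]
    exact h
  · apply e.repr.injective
    ext i
    have h := congrArg Complex.im (congrFun hv' i)
    simp only [Matrix.mulVec, dotProduct, complexMatrix, Matrix.map_apply, Complex.im_sum,
      Complex.coe_algebraMap, Complex.ofReal_re, Complex.ofReal_im, zero_mul, add_zero, Pi.smul_apply, smul_eq_mul,
      Complex.mul_im] at h
    rw [hcoord]
    simp only [map_add, map_smul, Finsupp.add_apply, Finsupp.smul_apply, hsymm, smul_eq_mul,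
      Matrix.mulVec, dotProduct]
    exact h.trans (add_comm _ _)

end Complexify

/-! ### What the output derivatives determine -/

section Trajectory

variable {X U Y Z : Type*} [NormedAddCommGroup X] [NormedSpace ℝ X]
  [NormedAddCommGroup U] [NormedSpace ℝ U]
  [NormedAddCommGroup Y] [NormedSpace ℝ Y]
  [NormedAddCommGroup Z] [NormedSpace ℝ Z]

/-- `(u, x)` satisfies `ẋ = A x + B u` on `[0, T]`. -/
def IsTrajectory (A : X →L[ℝ] X) (B : U →L[ℝ] X) (T : ℝ) (u : ℝ → U) (x : ℝ → X) : Prop :=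
  ∀ t ∈ Icc 0 T, HasDerivWithinAt x (A (x t) + B (u t)) (Icc 0 T) t

/-- Bootstrapping: `ẋ` is linear in `x` and `u`, so `x` gains regularity until it is one order
smoother than `u`. -/
theorem IsTrajectory.contDiffOn {A : X →L[ℝ] X} {B : U →L[ℝ] X} {T : ℝ} {u : ℝ → U} {x : ℝ → X}
    (h : IsTrajectory A B T u x) (hT : 0 < T) (k : ℕ) (hu : ContDiffOn ℝ k u (Icc 0 T)) :
    ContDiffOn ℝ (k + 1 : ℕ) x (Icc 0 T) := by
  have hun := uniqueDiffOn_Icc hT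
  have hd : DifferentiableOn ℝ x (Icc 0 T) := fun t ht => (h t ht).differentiableWithinAt
  have hderiv : ∀ t ∈ Icc 0 T, derivWithin x (Icc 0 T) t = A (x t) + B (u t) :=
    fun t ht => (h t ht).derivWithin (hun t ht)
  have step : ∀ j : ℕ, j ≤ k → ContDiffOn ℝ j x (Icc 0 T) →
      ContDiffOn ℝ (j + 1 : ℕ) x (Icc 0 T) := by
    intro j hj hx
    rw [Nat.cast_add, Nat.cast_one, contDiffOn_succ_iff_derivWithin hun]
    refine ⟨hd, fun h => absurd h (by simp), ?_⟩
    refine ContDiffOn.congr ?_ hderiv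
    exact (A.contDiff.comp_contDiffOn hx).add
      (B.contDiff.comp_contDiffOn (hu.of_le (by exact_mod_cast hj)))
  have all : ∀ j : ℕ, j ≤ k → ContDiffOn ℝ j x (Icc 0 T) := by
    intro j
    induction j with
    | zero => exact fun _ => by simpa using hd.continuousOn
    | succ i ih => exact fun hi => step i (by omega) (ih (by omega))
  exact step k le_rfl (all k le_rfl)

/-- The functional `ψ` of state and input is a combination of the output derivatives up to
order `N` along all trajectories. -/
def OutputDetermines (A : X →L[ℝ] X) (B : U →L[ℝ] X) (C : X →L[ℝ] Y) (N : ℕ)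
    (ψ : Module.Dual ℝ (X × U)) : Prop :=
  ∃ c : ℕ → Y →L[ℝ] ℝ, ∀ (T : ℝ) (u : ℝ → U) (x : ℝ → X), 0 < T →
    ContDiffOn ℝ N u (Icc 0 T) → IsTrajectory A B T u x → ∀ t ∈ Icc 0 T,
      ψ (x t, u t) =
        ∑ j ∈ Finset.range (N + 1), c j (iteratedDerivWithin j (fun s => C (x s)) (Icc 0 T) t)

variable {A : X →L[ℝ] X} {B : U →L[ℝ] X} {C : X →L[ℝ] Y}

theorem OutputDetermines.mono {N M : ℕ} {ψ : Module.Dual ℝ (X × U)}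
    (h : OutputDetermines A B C N ψ) (hNM : N ≤ M) : OutputDetermines A B C M ψ := by
  obtain ⟨c, hc⟩ := h
  refine ⟨fun j => if j ∈ Finset.range (N + 1) then c j else 0, fun T u x hT hu hx t ht => ?_⟩
  rw [hc T u x hT (hu.of_le (by exact_mod_cast hNM)) hx t ht]
  rw [← Finset.sum_subset (Finset.range_subset_range.2 (Nat.succ_le_succ hNM))]
  · exact Finset.sum_congr rfl fun j hj => by simp only; rw [if_pos hj]
  · intro j _ hj
    simp only
    rw [if_neg hj]
    rfl

/-- Differentiation along trajectories. -/
theorem OutputDetermines.deriv {N : ℕ} {φ : Module.Dual ℝ X} [FiniteDimensional ℝ X]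
    (h : OutputDetermines A B C N (φ ∘ₗ LinearMap.fst ℝ X U)) :
    OutputDetermines A B C (N + 1) (φ ∘ₗ (A.toLinearMap.coprod B.toLinearMap)) := by
  obtain ⟨c, hc⟩ := h
  -- Differentiating shifts the coefficients: order `0` gets `0`, order `j + 1` gets `c j`.
  refine ⟨fun j => Nat.casesOn j 0 c, fun T u x hT hu hx t ht => ?_⟩
  have hun := uniqueDiffOn_Icc hT
  have huN : ContDiffOn ℝ N u (Icc 0 T) := hu.of_le (by exact_mod_cast N.le_succ)
  have hy : ContDiffOn ℝ (N + 1 : ℕ) (fun s => C (x s)) (Icc 0 T) :=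
    C.contDiff.comp_contDiffOn (hx.contDiffOn hT N huN)
  have h1 : HasDerivWithinAt (fun s => φ (x s)) (φ (A (x t) + B (u t))) (Icc 0 T) t :=
    (LinearMap.toContinuousLinearMap φ).hasFDerivAt.comp_hasDerivWithinAt t (hx t ht)
  have h2 : HasDerivWithinAt
      (fun s => ∑ j ∈ Finset.range (N + 1),
        c j (iteratedDerivWithin j (fun s => C (x s)) (Icc 0 T) s))
      (∑ j ∈ Finset.range (N + 1),
        c j (iteratedDerivWithin (j + 1) (fun s => C (x s)) (Icc 0 T) t)) (Icc 0 T) t := by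
    refine HasDerivWithinAt.fun_sum fun j hj => ?_
    refine (c j).hasFDerivAt.comp_hasDerivWithinAt t ?_
    rw [iteratedDerivWithin_succ]
    refine (hy.differentiableOn_iteratedDerivWithin ?_ hun t ht).hasDerivWithinAt
    exact_mod_cast Finset.mem_range.1 hj
  have h3 := (h1.congr (fun s hs => (hc T u x hT huN hx s hs).symm)
    (hc T u x hT huN hx t ht).symm)
  rw [Finset.sum_range_succ']
  simpa using (hun t ht).eq_deriv _ h3 h2

/-- The subspace of functionals of state and input which the output determines. -/
def determinedFunctionals (A : X →L[ℝ] X) (B : U →L[ℝ] X) (C : X →L[ℝ] Y) :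
    Submodule ℝ (Module.Dual ℝ (X × U)) where
  carrier := {ψ | ∃ N, OutputDetermines A B C N ψ}
  zero_mem' := ⟨0, 0, fun T u x _ _ _ t _ => by simp⟩
  add_mem' := by
    rintro ψ₁ ψ₂ ⟨N₁, h₁⟩ ⟨N₂, h₂⟩
    obtain ⟨c₁, h₁⟩ := h₁.mono (le_max_left N₁ N₂)
    obtain ⟨c₂, h₂⟩ := h₂.mono (le_max_right N₁ N₂)
    refine ⟨max N₁ N₂, c₁ + c₂, fun T u x hT hu hx t ht => ?_⟩
    simp [h₁ T u x hT hu hx t ht, h₂ T u x hT hu hx t ht, Finset.sum_add_distrib]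
  smul_mem' := by
    rintro r ψ ⟨N, c, h⟩
    refine ⟨N, r • c, fun T u x hT hu hx t ht => ?_⟩
    simp [h T u x hT hu hx t ht, Finset.mul_sum]

theorem output_mem_determinedFunctionals [FiniteDimensional ℝ Y] (χ : Module.Dual ℝ Y) :
    χ ∘ₗ C.toLinearMap ∘ₗ LinearMap.fst ℝ X U ∈ determinedFunctionals A B C :=
  ⟨0, fun _ => LinearMap.toContinuousLinearMap χ, fun T u x _ _ _ t _ => by simp⟩

/-- A linear function of state and input all of whose components the output determines is bounded
by finitely many output derivatives. -/
theorem exists_bound_of_determined [FiniteDimensional ℝ Z] (G : X × U →ₗ[ℝ] Z)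
    (hG : ∀ χ : Module.Dual ℝ Z, χ ∘ₗ G ∈ determinedFunctionals A B C) :
    ∃ (N : ℕ) (K : ℝ), 0 ≤ K ∧ ∀ (T : ℝ) (u : ℝ → U) (x : ℝ → X), 0 < T →
      ContDiffOn ℝ N u (Icc 0 T) → IsTrajectory A B T u x → ∀ t ∈ Icc 0 T, ∀ R,
      (∀ j ≤ N, ‖iteratedDerivWithin j (fun s => C (x s)) (Icc 0 T) t‖ ≤ R) →
      ‖G (x t, u t)‖ ≤ K * R := by
  set e := Module.finBasis ℝ Z
  choose N₀ hN₀ using fun i => hG (e.coord i)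
  set N := Finset.univ.sup N₀
  choose c hc using fun i => (hN₀ i).mono (Finset.le_sup (f := N₀) (Finset.mem_univ i))
  refine ⟨N, ∑ i, (∑ j ∈ Finset.range (N + 1), ‖c i j‖) * ‖e i‖, by positivity,
    fun T u x hT hu hx t ht R hR => ?_⟩
  rw [← e.sum_repr (G (x t, u t)), Finset.sum_mul]
  refine (norm_sum_le _ _).trans (Finset.sum_le_sum fun i _ => ?_)
  rw [norm_smul]
  have h : e.repr (G (x t, u t)) i = _ := hc i T u x hT hu hx t ht
  rw [h, mul_right_comm, Finset.sum_mul]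
  gcongr
  refine (norm_sum_le _ _).trans (Finset.sum_le_sum fun j hj => ?_)
  refine ((c i j).le_opNorm _).trans ?_
  gcongr
  exact hR j (Nat.lt_succ_iff.1 (Finset.mem_range.1 hj))

variable [FiniteDimensional ℝ X] [FiniteDimensional ℝ U] [FiniteDimensional ℝ Y]

/-- If `S` contains every controlled invariant subspace of `ker C`, and the input is determined by
the requirement of staying in `S`, then the output determines every functional that vanishes on the
graph of a friend over `S`. -/
theorem mem_determinedFunctionals {S : Submodule ℝ X} {F : X →ₗ[ℝ] U}
    (hF : ∀ v ∈ S, A v + B (F v) ∈ S)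
    (hmax : ∀ V : Submodule ℝ X, V ≤ LinearMap.ker C.toLinearMap →
      V.map A.toLinearMap ≤ V ⊔ LinearMap.range B.toLinearMap → V ≤ S)
    (hinj : ∀ v, B v ∈ S → v = 0) {ψ : Module.Dual ℝ (X × U)}
    (hψ : ∀ v ∈ S, ψ (v, F v) = 0) : ψ ∈ determinedFunctionals A B C := by
  set D := determinedFunctionals A B C with hD
  set D₁ : Submodule ℝ (Module.Dual ℝ X) := D.comap (LinearMap.fst ℝ X U).dualMap with hD₁
  have hderiv : ∀ φ ∈ D₁, φ ∘ₗ (A.toLinearMap.coprod B.toLinearMap) ∈ D :=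
    fun φ ⟨N, h⟩ => ⟨N + 1, OutputDetermines.deriv h⟩
  set V := D₁.dualCoannihilator with hV
  have hVmem : ∀ v, v ∈ V ↔ ∀ φ ∈ D₁, φ v = 0 := fun v => Submodule.mem_dualCoannihilator v
  have hVS : V ≤ S := by
    refine hmax V (fun v hv => ?_) ?_
    · rw [LinearMap.mem_ker, ← Module.forall_dual_apply_eq_zero_iff ℝ]
      intro χ
      have hχ : χ ∘ₗ C.toLinearMap ∈ D₁ := output_mem_determinedFunctionals χ
      exact (hVmem v).1 hv _ hχ
    -- By duality it suffices to test against `φ` killing `V` and `im B`. Such `φ` lies in `D₁`, and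
    -- its derivative `φ (A x + B u) = φ (A x)` is again a state functional, hence in `D₁`.
    · rw [← Subspace.dualAnnihilator_dualCoannihilator_eq
        (W := V ⊔ LinearMap.range B.toLinearMap)]
      rintro _ ⟨v, hv, rfl⟩
      rw [Submodule.mem_dualCoannihilator]
      intro φ hφ
      rw [Submodule.dualAnnihilator_sup_eq, hV, Subspace.dualCoannihilator_dualAnnihilator_eq]
        at hφ
      obtain ⟨hφ₁, hφ₂⟩ := hφ
      have hφB : ∀ w, φ (B w) = 0 := fun w =>
        (Submodule.mem_dualAnnihilator φ).1 hφ₂ _ ⟨w, rfl⟩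
      have hmem : φ ∘ₗ A.toLinearMap ∈ D₁ := by
        have h := hderiv φ hφ₁
        have e : φ ∘ₗ (A.toLinearMap.coprod B.toLinearMap) =
            (φ ∘ₗ A.toLinearMap) ∘ₗ LinearMap.fst ℝ X U := by
          ext w <;> simp [hφB]
        rwa [e] at h
      exact (hVmem v).1 hv _ hmem
  -- For a common zero `(x, u)`, both `x` and `A x + B u` lie in `V ≤ S`. Subtracting `A x + B (F
  -- x)` leaves `B (u - F x) ∈ S`.
  have key : ∀ p ∈ D.dualCoannihilator, p.1 ∈ S ∧ p.2 = F p.1 := by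
    intro p hp
    rw [Submodule.mem_dualCoannihilator] at hp
    have h1 : p.1 ∈ S := hVS ((hVmem _).2 fun φ hφ => hp _ hφ)
    have h2 : A p.1 + B p.2 ∈ S := hVS ((hVmem _).2 fun φ hφ => hp _ (hderiv φ hφ))
    refine ⟨h1, sub_eq_zero.1 (hinj _ ?_)⟩
    have h3 := S.sub_mem h2 (hF _ h1)
    rwa [add_sub_add_left_eq_sub, ← map_sub] at h3
  rw [← Subspace.dualCoannihilator_dualAnnihilator_eq (W := D), Submodule.mem_dualAnnihilator]
  intro p hp
  obtain ⟨h1, h2⟩ := key p hp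
  have := hψ p.1 h1
  rwa [← h2] at this

/-- If moreover the zero dynamics `f = (A + B F)|S` is Hurwitz, state and input are bounded by a
decaying term and finitely many output derivatives. -/
theorem exists_state_input_bound {S : Submodule ℝ X} {F : X →ₗ[ℝ] U} (f : S →ₗ[ℝ] S)
    (hf : ∀ v : S, (f v : X) = A v + B (F v))
    (hmax : ∀ V : Submodule ℝ X, V ≤ LinearMap.ker C.toLinearMap →
      V.map A.toLinearMap ≤ V ⊔ LinearMap.range B.toLinearMap → V ≤ S)
    (hinj : ∀ v, B v ∈ S → v = 0)
    (hroots : ∀ μ : ℂ, Polynomial.aeval μ f.charpoly = 0 → μ.re < 0) :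
    ∃ (N : ℕ) (K lam : ℝ), 0 ≤ K ∧ 0 < lam ∧ ∀ (T : ℝ) (u : ℝ → U) (x : ℝ → X), 0 < T →
      ContDiffOn ℝ N u (Icc 0 T) → IsTrajectory A B T u x → ∀ t ∈ Icc 0 T, ∀ R,
      (∀ s ∈ Icc 0 t, ∀ j ≤ N, ‖iteratedDerivWithin j (fun s => C (x s)) (Icc 0 T) s‖ ≤ R) →
      ‖u t‖ + ‖x t‖ ≤ K * (‖x 0‖ * Real.exp (-lam * t) + R) := by
  obtain ⟨π, hπ⟩ := S.subtype.exists_leftInverse_of_injective S.ker_subtype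
  have hπS : ∀ v : S, π v = v := fun v => LinearMap.congr_fun hπ v
  -- `G` measures the deviation of `(x, u)` from the graph of `F` over `S`.
  set G : X × U →ₗ[ℝ] X × U :=
    ((LinearMap.fst ℝ X U) - (S.subtype ∘ₗ π) ∘ₗ LinearMap.fst ℝ X U).prod
      (LinearMap.snd ℝ X U - F ∘ₗ LinearMap.fst ℝ X U) with hG
  have hGapp : ∀ x u, G (x, u) = (x - (π x : X), u - F x) := fun x u => rfl
  have hFS : ∀ v ∈ S, A v + B (F v) ∈ S := fun v hv => by
    rw [← hf ⟨v, hv⟩]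
    exact (f _).2
  obtain ⟨N, K₁, hK₁, hGb⟩ := exists_bound_of_determined (A := A) (B := B) (C := C) G
    (fun χ => mem_determinedFunctionals hFS hmax hinj fun v hv => by
      have h : (π v : X) = v := congrArg Subtype.val (hπS ⟨v, hv⟩)
      rw [LinearMap.comp_apply, hGapp, h, sub_self, sub_self]
      exact map_zero χ)
  obtain ⟨K₂, lam, hK₂, hlam, hdec⟩ := exists_decay_of_charpoly f hroots
  set Pr : X →L[ℝ] S := LinearMap.toContinuousLinearMap π with hPr
  set F' : X →L[ℝ] U := LinearMap.toContinuousLinearMap F with hF'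
  -- Chosen so that `π x` has derivative `f (π x) + Q (x - π x, u - F x)`.
  set Q : X × U →L[ℝ] S :=
    Pr.comp ((A + B.comp F').coprod B) with hQ
  set K₃ : ℝ := K₂ * (‖Pr‖ + ‖Q‖ * K₁) + K₁ with hK₃
  have hK₃0 : 0 ≤ K₃ := by positivity
  refine ⟨N, K₃ + (K₁ + ‖F'‖ * K₃), lam, by positivity, hlam, ?_⟩
  intro T u x hT hu hx t ht R hR
  have hsub : Icc 0 t ⊆ Icc 0 T := Icc_subset_Icc_right ht.2
  have hR0 : 0 ≤ R := (norm_nonneg _).trans (hR t ⟨ht.1, le_rfl⟩ 0 (Nat.zero_le _))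
  have hGs : ∀ s ∈ Icc 0 t, ‖(x s - (π (x s) : X), u s - F (x s))‖ ≤ K₁ * R :=
    fun s hs => hGb T u x hT hu hx s (hsub hs) R (hR s hs)
  -- The horizon is `t`, not `T`, since `R` bounds the output derivatives only up to time `t`.
  have hs := hdec t (‖Q‖ * (K₁ * R)) (fun s => Pr (x s))
    (fun s => Q (x s - (π (x s) : X), u s - F (x s)))
    (fun s hs => by
      have h := Pr.hasFDerivAt.comp_hasDerivWithinAt s ((hx s (hsub hs)).mono hsub)
      refine h.congr_deriv ?_
      have e : f (Pr (x s)) = Pr (A (π (x s)) + B (F (π (x s)))) := by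
        rw [← hf]
        exact (hπS _).symm
      rw [e, hQ]
      simp only [ContinuousLinearMap.comp_apply, ContinuousLinearMap.coprod_apply, ← map_add,
        _root_.add_apply]
      congr 1
      simp only [hF', LinearMap.coe_toContinuousLinearMap', map_sub]
      abel)
    (fun s hs => (Q.le_opNorm _).trans (by gcongr; exact hGs s hs)) t ⟨ht.1, le_rfl⟩
  set E := ‖x 0‖ * Real.exp (-lam * t) with hE
  have hE0 : 0 ≤ E := by positivity
  have h1 : ‖(π (x t) : X)‖ ≤ K₂ * (‖Pr‖ * E + ‖Q‖ * (K₁ * R)) := by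
    refine hs.trans ?_
    refine mul_le_mul_of_nonneg_left (add_le_add_left ?_ _) hK₂
    rw [hE, ← mul_assoc]
    exact mul_le_mul_of_nonneg_right (Pr.le_opNorm _) (Real.exp_pos _).le
  have h2 := hGs t ⟨ht.1, le_rfl⟩
  have h3 : ‖x t - (π (x t) : X)‖ ≤ K₁ * R := (norm_fst_le _).trans h2
  have h4 : ‖u t - F (x t)‖ ≤ K₁ * R := (norm_snd_le _).trans h2
  have h5 : ‖x t‖ ≤ K₃ * (E + R) := by
    have h := norm_add_le (x t - (π (x t) : X)) (π (x t) : X)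
    rw [sub_add_cancel] at h
    have e : K₃ * (E + R) = K₂ * (‖Pr‖ * E + ‖Q‖ * (K₁ * R)) + K₁ * R +
        (K₂ * ‖Pr‖ * R + K₂ * (‖Q‖ * K₁) * E + K₁ * E) := by rw [hK₃]; ring
    have : 0 ≤ K₂ * ‖Pr‖ * R + K₂ * (‖Q‖ * K₁) * E + K₁ * E := by positivity
    linarith
  have h6 : ‖u t‖ ≤ (K₁ + ‖F'‖ * K₃) * (E + R) := by
    have h := norm_add_le (u t - F (x t)) (F (x t))
    rw [sub_add_cancel] at h
    have h' : ‖F (x t)‖ ≤ ‖F'‖ * (K₃ * (E + R)) :=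
      (F'.le_opNorm (x t)).trans (by gcongr)
    have : 0 ≤ K₁ * E := by positivity
    nlinarith
  linarith

end Trajectory

/-! ### Linear equations with constant input -/

/-- Solvability of `ż = f z + v`, `z 0 = 0`. -/
theorem exists_solution_of_const_input {V : Type*} [NormedAddCommGroup V] [NormedSpace ℝ V]
    [FiniteDimensional ℝ V] (f : V →ₗ[ℝ] V) (v : V) :
    ∃ z : ℝ → V, z 0 = 0 ∧ ∀ t, HasDerivAt z (f (z t) + v) t := by
  have : CompleteSpace (V × ℝ) := FiniteDimensional.complete ℝ _
  -- The constant input becomes an extra coordinate that stays equal to `1`, so the exponential of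
  -- one linear map solves the equation.
  set L : V × ℝ →L[ℝ] V × ℝ := LinearMap.toContinuousLinearMap
    ((f.coprod (LinearMap.toSpanSingleton ℝ V v)).prod 0) with hL
  have hLapp : ∀ p : V × ℝ, L p = (f p.1 + p.2 • v, 0) := fun p => rfl
  set p : ℝ → V × ℝ := fun t => NormedSpace.exp (t • L) (0, 1) with hp
  have hp0 : p 0 = (0, 1) := by simp [hp]
  have hpd : ∀ t, HasDerivAt p (L (p t)) t := by
    intro t
    exact (ContinuousLinearMap.apply ℝ (V × ℝ) ((0, 1) : V × ℝ)).hasFDerivAt.comp_hasDerivAt t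
      (hasDerivAt_exp_smul_const' L t)
  have h2 : ∀ t, (p t).2 = 1 := by
    have hd : ∀ t, HasDerivAt (fun t => (p t).2) 0 t := fun t =>
      (ContinuousLinearMap.snd ℝ V ℝ).hasFDerivAt.comp_hasDerivAt t (hpd t)
    intro t
    have := is_const_of_deriv_eq_zero (fun t => (hd t).differentiableAt) (fun t => (hd t).deriv) t 0
    simpa [hp0] using this
  refine ⟨fun t => (p t).1, by simp [hp0], fun t => ?_⟩
  have h := (ContinuousLinearMap.fst ℝ V ℝ).hasFDerivAt.comp_hasDerivAt t (hpd t)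
  refine h.congr_deriv ?_
  simp [hLapp, h2]

/-! ### Jets and supremum norms -/

section Jet

variable {l : ℕ} {z : ℝ → EuclideanSpace ℝ (Fin l)} {N : ℕ} {I : Set ℝ}

theorem norm_iteratedDerivWithin_le_jet (hz : ContDiffOn ℝ N z I) (hI : UniqueDiffOn ℝ I) {s : ℝ}
    (hs : s ∈ I) {j : ℕ} (hj : j ≤ N) : ‖iteratedDerivWithin j z I s‖ ≤ ‖jet z N I s‖ := by
  have hcomp : ∀ i, (iteratedDerivWithin j z I s) i =
      iteratedDerivWithin j (fun r => z r i) I s := by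
    intro i
    have h := (EuclideanSpace.proj (𝕜 := ℝ) i : EuclideanSpace ℝ (Fin l) →L[ℝ] ℝ)
      |>.iteratedFDerivWithin_comp_left (hz s hs) hI hs (i := j) (by exact_mod_cast hj)
    rw [iteratedDerivWithin_eq_iteratedFDerivWithin, iteratedDerivWithin_eq_iteratedFDerivWithin]
    exact (congrArg (fun q => q fun _ => (1 : ℝ)) h).symm
  rw [EuclideanSpace.norm_eq, EuclideanSpace.norm_eq]
  apply Real.sqrt_le_sqrt
  rw [Fintype.sum_prod_type]
  refine Finset.sum_le_sum fun i _ => ?_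
  rw [hcomp]
  exact Finset.single_le_sum (f := fun k : Fin (N + 1) => ‖jet z N I s (i, k)‖ ^ 2)
    (fun _ _ => sq_nonneg _) (Finset.mem_univ (⟨j, Nat.lt_succ_of_le hj⟩ : Fin (N + 1)))

theorem continuousOn_jet (hz : ContDiffOn ℝ N z I) (hI : UniqueDiffOn ℝ I) :
    ContinuousOn (jet z N I) I := by
  refine (PiLp.continuous_toLp 2 _).comp_continuousOn (continuousOn_pi.2 fun p => ?_)
  refine ContDiffOn.continuousOn_iteratedDerivWithin (n := N) ?_ ?_ hI
  · exact (EuclideanSpace.proj (𝕜 := ℝ) p.1 : EuclideanSpace ℝ (Fin l) →L[ℝ] ℝ).contDiff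
      |>.comp_contDiffOn hz
  · exact_mod_cast Nat.lt_succ_iff.1 p.2.2

/-- Continuity on a compact interval matters: `sSup` of an unbounded set in `ℝ≥0` takes the default
value `0`. -/
theorem norm_le_supNorm {E : Type*} [NormedAddCommGroup E] {y : ℝ → E} {a b s : ℝ}
    (hy : ContinuousOn y (Icc a b)) (hs : s ∈ Icc a b) : ‖y s‖ ≤ supNorm y a b :=
  NNReal.coe_le_coe.2 (le_csSup (isCompact_Icc.image_of_continuousOn hy.nnnorm).bddAbove
    (mem_image_of_mem _ hs))

theorem supNorm_jet_zero {T t : ℝ} (ht : 0 ≤ t) :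
    supNorm (jet (fun _ => (0 : EuclideanSpace ℝ (Fin l))) N (Icc 0 T)) 0 t = 0 := by
  have h : jet (fun _ => (0 : EuclideanSpace ℝ (Fin l))) N (Icc 0 T) = fun _ => 0 := by
    funext s
    ext p
    simp [jet]
  rw [h, supNorm]
  simp [(nonempty_Icc.2 ht).image_const]

end Jet

/-! ### Left-invertible systems and sufficiency -/

variable {n m l : ℕ} {A : Matrix (Fin n) (Fin n) ℝ} {B : Matrix (Fin n) (Fin m) ℝ}
  {C : Matrix (Fin l) (Fin n) ℝ}

theorem toEuclideanLin_closedLoop (F : Matrix (Fin m) (Fin n) ℝ) (v : EuclideanSpace ℝ (Fin n)) :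
    (A + B * F).toEuclideanLin v =
      A.toEuclideanLin v + B.toEuclideanLin (F.toEuclideanLin v) := by
  ext i
  simp [Matrix.toLpLin_apply, Matrix.mulVec_mulVec]

theorem output_eq_zero {v : EuclideanSpace ℝ (Fin n)} (hv : v ∈ maxInvariant A B C) :
    C.toEuclideanLin v = 0 :=
  (isGreatest_maxInvariant A B C).1.2 hv

/-- For a left-invertible system `B` is injective and `im B ∩ 𝒮 = 0`. -/
theorem IsLeftInvertible.eq_zero_of_mem (hinv : IsLeftInvertible A B C)
    {w : EuclideanSpace ℝ (Fin m)} (hw : B.toEuclideanLin w ∈ maxInvariant A B C) : w = 0 := by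
  obtain ⟨F, hF⟩ := (isGreatest_maxInvariant A B C).1.1
  -- Started at `0` and solved inside `𝒮`, the input `F z + w` produces zero output, as does the
  -- zero input. The two must agree, and at time `0` the former is `w`.
  obtain ⟨z, hz0, hz⟩ := exists_solution_of_const_input ((A + B * F).toEuclideanLin.restrict hF)
    (⟨_, hw⟩ : maxInvariant A B C)
  have hx : ∀ t, HasDerivAt (fun t => (z t : EuclideanSpace ℝ (Fin n)))
      ((A + B * F).toEuclideanLin (z t) + B.toEuclideanLin w) t := fun t =>
    (maxInvariant A B C).subtypeL.hasFDerivAt.comp_hasDerivAt t (hz t)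
  have hcont : Continuous fun t => (z t : EuclideanSpace ℝ (Fin n)) :=
    continuous_iff_continuousAt.2 fun t => (hx t).continuousAt
  have h := hinv (fun t => F.toEuclideanLin (z t) + w) (fun _ => 0) (fun t => z t) (fun _ => 0)
    ((F.toEuclideanLin.continuous_of_finiteDimensional.comp hcont).add
      continuous_const).continuousOn continuousOn_const
    (fun t _ => by
      refine (hx t).hasDerivWithinAt.congr_deriv ?_
      rw [toEuclideanLin_closedLoop]
      simp only [linearSystem, map_add]
      abel)
    (fun t _ => by simpa [linearSystem] using hasDerivWithinAt_const t (Ici (0 : ℝ)) 0)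
    (by simp [hz0]) rfl
    (fun t _ => by rw [output_eq_zero (z t).2, map_zero]) 0 self_mem_Ici
  simpa [hz0] using h

theorem isClassKInf_const_mul {K : ℝ≥0} (hK : 0 < K) : IsClassKInf fun s => K * s where
  continuous := continuous_const.mul continuous_id
  strictMono := fun _ _ h => mul_lt_mul_of_pos_left h hK
  map_zero := mul_zero K
  unbounded := fun M => ⟨(M + 1) / K, by
    rw [mul_div_cancel₀ _ hK.ne']
    exact lt_add_one M⟩

theorem isClassKL_const_mul_exp {K : ℝ≥0} (hK : 0 < K) {lam : ℝ} (hlam : 0 < lam) :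
    IsClassKL fun s t => K * s * (Real.exp (-lam * t)).toNNReal where
  classK t := by
    have hpos : 0 < (Real.exp (-lam * t)).toNNReal := Real.toNNReal_pos.2 (Real.exp_pos _)
    have h := (isClassKInf_const_mul (mul_pos hK hpos)).toIsClassK
    convert h using 2
    ring
  antitone s t₁ t₂ h := by
    refine mul_le_mul_right (Real.toNNReal_le_toNNReal (Real.exp_le_exp.2 ?_)) _
    have : (t₁ : ℝ) ≤ t₂ := h
    nlinarith
  tendsto_zero s := by
    have h1 : Tendsto (fun t : ℝ≥0 => Real.exp (-lam * t)) atTop (𝓝 0) := by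
      refine Real.tendsto_exp_atBot.comp ?_
      exact (NNReal.tendsto_coe_atTop.2 tendsto_id).const_mul_atTop_of_neg (by linarith)
    have h2 := (tendsto_real_toNNReal h1).const_mul (K * s)
    simpa using h2

/-- A left-invertible linear system with stable transmission zeros is output-input stable. -/
theorem isOutputInputStable_of_zeros (hinv : IsLeftInvertible A B C)
    (hzeros : ∀ μ : ℂ, IsTransmissionZero A B C μ → μ.re < 0) :
    (linearSystem A B C).IsOutputInputStable := by
  have hgreat := isGreatest_maxInvariant A B C
  obtain ⟨F, hF⟩ := hgreat.1.1
  obtain ⟨N, K, lam, hK, hlam, hbound⟩ := exists_state_input_bound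
    (A := A.toEuclideanLin.toContinuousLinearMap) (B := B.toEuclideanLin.toContinuousLinearMap)
    (C := C.toEuclideanLin.toContinuousLinearMap) (F := F.toEuclideanLin)
    ((A + B * F).toEuclideanLin.restrict hF) (fun v => toEuclideanLin_closedLoop F v)
    (fun V hVC hVA => hgreat.2 ⟨(exists_isFriend_iff A B V).2 hVA, hVC⟩)
    (fun v hv => hinv.eq_zero_of_mem hv) (fun μ hμ => hzeros μ ⟨F, hF, hμ⟩)
  -- `K` may vanish, but gains of class `𝒦` must be strictly increasing.
  set K' : ℝ≥0 := K.toNNReal + 1 with hK'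
  have hK'0 : 0 < K' := by positivity
  have hKK' : K ≤ K' := by
    rw [hK', NNReal.coe_add, Real.coe_toNNReal _ hK]
    simp
  -- With `N + 1` the order is positive and inputs are of class `C^N`, as the bound requires; the
  -- output then has `N + 1` continuous derivatives.
  refine ⟨N + 1, _, _, N.succ_pos, isClassKL_const_mul_exp hK'0 hlam, isClassKInf_const_mul hK'0,
    fun u hu T x hT hx t ht => ?_⟩
  have hun := uniqueDiffOn_Icc hT
  have hu' : ContDiffOn ℝ N u (Icc 0 T) := hu.mono Icc_subset_Ici_self
  have htraj : IsTrajectory A.toEuclideanLin.toContinuousLinearMap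
      B.toEuclideanLin.toContinuousLinearMap T u x := hx
  have hy : ContDiffOn ℝ (N + 1 : ℕ) (fun s => (linearSystem A B C).h (x s)) (Icc 0 T) :=
    (linearSystem A B C).smooth_h.of_le (by exact_mod_cast le_top)
      |>.comp_contDiffOn (htraj.contDiffOn hT N hu')
  have hsub : Icc 0 t ⊆ Icc 0 T := Icc_subset_Icc_right ht.2
  have h := hbound T u x hT hu' htraj t ht
    (supNorm (jet (fun s => (linearSystem A B C).h (x s)) (N + 1) (Icc 0 T)) 0 t)
    (fun s hs j hj => (norm_iteratedDerivWithin_le_jet hy hun (hsub hs) (by omega)).trans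
      (norm_le_supNorm ((continuousOn_jet hy hun).mono hsub) hs))
  rw [← NNReal.coe_le_coe]
  have hsum : ‖(WithLp.toLp 2 (u t, x t) :
      WithLp 2 (EuclideanSpace ℝ (Fin m) × EuclideanSpace ℝ (Fin n)))‖ ≤ ‖u t‖ + ‖x t‖ := by
    rw [WithLp.prod_norm_eq_of_L2]
    refine Real.sqrt_le_iff.2 ⟨by positivity, ?_⟩
    change ‖u t‖ ^ 2 + ‖x t‖ ^ 2 ≤ _
    have := mul_nonneg (norm_nonneg (u t)) (norm_nonneg (x t))
    nlinarith
  refine (hsum.trans h).trans ?_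
  simp only [NNReal.coe_add, NNReal.coe_mul, coe_nnnorm, Real.coe_toNNReal _ (Real.exp_pos _).le,
    Real.coe_toNNReal _ ht.1]
  rw [mul_assoc, ← mul_add]
  gcongr

/-! ### Necessity -/

/-- Trajectories of the zero dynamics of an output-input stable linear system decay. -/
theorem tendsto_zero_of_isOutputInputStable (h : (linearSystem A B C).IsOutputInputStable)
    {F : Matrix (Fin m) (Fin n) ℝ} {x : ℝ → EuclideanSpace ℝ (Fin n)}
    (hx : ∀ t, HasDerivAt x ((A + B * F).toEuclideanLin (x t)) t)
    (hxC : ∀ t, C.toEuclideanLin (x t) = 0) : Tendsto x atTop (𝓝 0) := by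
  obtain ⟨N, β, γ, -, hβ, hγ, h⟩ := h
  have hcd : ∀ k : ℕ, ContDiff ℝ k x := by
    intro k
    induction k with
    | zero => exact contDiff_zero.2 (continuous_iff_continuousAt.2 fun t => (hx t).continuousAt)
    | succ k ih =>
      rw [Nat.cast_add, Nat.cast_one, contDiff_succ_iff_deriv]
      refine ⟨fun t => (hx t).differentiableAt, fun h => absurd h (by simp), ?_⟩
      rw [show deriv x = fun t => (A + B * F).toEuclideanLin (x t) from
        funext fun t => (hx t).deriv]
      exact (A + B * F).toEuclideanLin.toContinuousLinearMap.contDiff.comp ih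
  have hle : ∀ t : ℝ, 0 ≤ t → ‖x t‖ ≤ β ‖x 0‖₊ t.toNNReal := by
    intro t ht
    -- The horizon `t + 1` is positive even when `t = 0`.
    have h1 := h (fun t => F.toEuclideanLin (x t))
      (F.toEuclideanLin.toContinuousLinearMap.contDiff.comp (hcd _)).contDiffOn (t + 1) x
      (by linarith) (fun s _ => by
        refine (hx s).hasDerivWithinAt.congr_deriv ?_
        rw [toEuclideanLin_closedLoop]
        rfl) t ⟨ht, by linarith⟩
    have h2 : (fun s => (linearSystem A B C).h (x s)) = fun _ => 0 := funext hxC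
    rw [h2, supNorm_jet_zero ht, hγ.map_zero, add_zero, ← NNReal.coe_le_coe] at h1
    refine le_trans ?_ h1
    rw [coe_nnnorm, WithLp.prod_norm_eq_of_L2]
    exact Real.le_sqrt_of_sq_le (le_add_of_nonneg_left (sq_nonneg _))
  have hlim : Tendsto (fun t : ℝ => (β ‖x 0‖₊ t.toNNReal : ℝ)) atTop (𝓝 0) := by
    have := (hβ.tendsto_zero ‖x 0‖₊).comp tendsto_real_toNNReal_atTop
    exact NNReal.tendsto_coe.2 this
  exact squeeze_zero_norm' ((eventually_ge_atTop 0).mono hle) hlim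

/-- The transmission zeros of an output-input stable linear system have negative real parts. -/
theorem re_neg_of_isTransmissionZero (h : (linearSystem A B C).IsOutputInputStable) {μ : ℂ}
    (hμ : IsTransmissionZero A B C μ) : μ.re < 0 := by
  obtain ⟨F, hF, hroot⟩ := hμ
  obtain ⟨a, b, hab, ha, hb⟩ := exists_eigenpair_of_charpoly_root _ μ hroot
  have ha' : (A + B * F).toEuclideanLin (a : EuclideanSpace ℝ (Fin n)) =
      μ.re • (a : EuclideanSpace ℝ (Fin n)) - μ.im • (b : EuclideanSpace ℝ (Fin n)) :=
    congrArg Subtype.val ha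
  have hb' : (A + B * F).toEuclideanLin (b : EuclideanSpace ℝ (Fin n)) =
      μ.im • (a : EuclideanSpace ℝ (Fin n)) + μ.re • (b : EuclideanSpace ℝ (Fin n)) :=
    congrArg Subtype.val hb
  by_contra! hre
  -- `p + i q = exp (μ t)`; below, `x₁` and `x₂` are the real and imaginary parts of `exp (μ t) (a +
  -- i b)`.
  set p : ℝ → ℝ := fun t => Real.exp (μ.re * t) * Real.cos (μ.im * t)
  set q : ℝ → ℝ := fun t => Real.exp (μ.re * t) * Real.sin (μ.im * t)
  have hlin : ∀ c t : ℝ, HasDerivAt (fun t => c * t) c t := fun c t => by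
    simpa using (hasDerivAt_id t).const_mul c
  have hp : ∀ t, HasDerivAt p (μ.re * p t - μ.im * q t) t := fun t =>
    ((hlin μ.re t).exp.mul (hlin μ.im t).cos).congr_deriv (by simp only [p, q]; ring)
  have hq : ∀ t, HasDerivAt q (μ.im * p t + μ.re * q t) t := fun t =>
    ((hlin μ.re t).exp.mul (hlin μ.im t).sin).congr_deriv (by simp only [p, q]; ring)
  set x₁ : ℝ → EuclideanSpace ℝ (Fin n) := fun t => p t • (a : EuclideanSpace ℝ (Fin n)) -
    q t • (b : EuclideanSpace ℝ (Fin n))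
  set x₂ : ℝ → EuclideanSpace ℝ (Fin n) := fun t => q t • (a : EuclideanSpace ℝ (Fin n)) +
    p t • (b : EuclideanSpace ℝ (Fin n))
  have h₁ : Tendsto x₁ atTop (𝓝 0) := by
    refine tendsto_zero_of_isOutputInputStable h (F := F) (fun t => ?_) fun t =>
      output_eq_zero (Submodule.sub_mem _ (Submodule.smul_mem _ _ a.2)
        (Submodule.smul_mem _ _ b.2))
    refine (((hp t).smul_const _).sub ((hq t).smul_const _)).congr_deriv ?_
    simp only [x₁, map_sub, map_smul, ha', hb']
    module
  have h₂ : Tendsto x₂ atTop (𝓝 0) := by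
    refine tendsto_zero_of_isOutputInputStable h (F := F) (fun t => ?_) fun t =>
      output_eq_zero (Submodule.add_mem _ (Submodule.smul_mem _ _ a.2)
        (Submodule.smul_mem _ _ b.2))
    refine (((hq t).smul_const _).add ((hp t).smul_const _)).congr_deriv ?_
    simp only [x₂, LinearMap.map_add, LinearMap.map_smul, ha', hb']
    module
  have hsum : Tendsto (fun t => ‖x₁ t‖ + ‖x₂ t‖) atTop (𝓝 0) := by
    simpa using h₁.norm.add h₂.norm
  have hexp : ∀ t : ℝ, 0 ≤ t → 1 ≤ Real.exp (μ.re * t) := fun t ht =>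
    Real.one_le_exp (mul_nonneg hre ht)
  have hrot : ∀ t : ℝ, Real.cos (μ.im * t) * Real.cos (μ.im * t) +
      Real.sin (μ.im * t) * Real.sin (μ.im * t) = 1 := fun t => by
    have := Real.sin_sq_add_cos_sq (μ.im * t)
    nlinarith
  -- Rotating back by the angle `μ.im * t` recovers `exp (μ.re * t)` times `a` or `b` with
  -- coefficients bounded by `1`. As that factor is at least `1`, decay of `x₁` and `x₂` forces `a =
  -- b = 0`.
  have hzero : ∀ (v : EuclideanSpace ℝ (Fin n)) (c₁ c₂ : ℝ → ℝ), (∀ t, |c₁ t| ≤ 1) →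
      (∀ t, |c₂ t| ≤ 1) →
      (∀ t, Real.exp (μ.re * t) • v = c₁ t • x₁ t + c₂ t • x₂ t) → v = 0 := by
    intro v c₁ c₂ hc₁ hc₂ hv
    have hle : ∀ᶠ t : ℝ in atTop, ‖v‖ ≤ ‖x₁ t‖ + ‖x₂ t‖ := by
      filter_upwards [eventually_ge_atTop 0] with t ht
      calc ‖v‖ ≤ Real.exp (μ.re * t) * ‖v‖ := le_mul_of_one_le_left (norm_nonneg _) (hexp t ht)
        _ = ‖c₁ t • x₁ t + c₂ t • x₂ t‖ := by
            rw [← hv, norm_smul, Real.norm_of_nonneg (Real.exp_pos _).le]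
        _ ≤ |c₁ t| * ‖x₁ t‖ + |c₂ t| * ‖x₂ t‖ := by
            refine (norm_add_le _ _).trans_eq ?_
            rw [norm_smul, norm_smul, Real.norm_eq_abs, Real.norm_eq_abs]
        _ ≤ 1 * ‖x₁ t‖ + 1 * ‖x₂ t‖ := by
            gcongr
            · exact hc₁ t
            · exact hc₂ t
        _ = _ := by ring
    exact norm_le_zero_iff.1 (ge_of_tendsto hsum hle)
  have ha0 : (a : EuclideanSpace ℝ (Fin n)) = 0 :=
    hzero a (fun t => Real.cos (μ.im * t)) (fun t => Real.sin (μ.im * t))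
      (fun t => Real.abs_cos_le_one _) (fun t => Real.abs_sin_le_one _) fun t => by
        simp only [x₁, x₂, p, q]
        match_scalars
        · linear_combination -Real.exp (μ.re * t) * hrot t
        · ring
  have hb0 : (b : EuclideanSpace ℝ (Fin n)) = 0 :=
    hzero b (fun t => -Real.sin (μ.im * t)) (fun t => Real.cos (μ.im * t))
      (fun t => by rw [abs_neg]; exact Real.abs_sin_le_one _)
      (fun t => Real.abs_cos_le_one _) fun t => by
        simp only [x₁, x₂, p, q]
        match_scalars
        · linear_combination -Real.exp (μ.re * t) * hrot t
        · ring
  rcases hab with h | h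
  · exact h (Subtype.ext ha0)
  · exact h (Subtype.ext hb0)

end OutputInput

theorem theorem2 (n m l : ℕ) (A : Matrix (Fin n) (Fin n) ℝ) (B : Matrix (Fin n) (Fin m) ℝ)
    (C : Matrix (Fin l) (Fin n) ℝ) (hinv : OutputInput.IsLeftInvertible A B C) :
    (OutputInput.linearSystem A B C).IsOutputInputStable ↔
      ∀ μ : ℂ, OutputInput.IsTransmissionZero A B C μ → μ.re < 0 :=
  ⟨fun h _ hμ => OutputInput.re_neg_of_isTransmissionZero h hμ,
    OutputInput.isOutputInputStable_of_zeros hinv⟩
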